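/- A \emph{type} of degree $d$ (written $\tau\vDash d$) is a finite multiset $\tau=\{(b_1,m_1),\dots,(b_r,m_r)\}$ of ordered pairs of positive integers with $\sum_i b_im_i=d$; write it as $\tau=(b_1^{m_1}\cdots b_r^{m_r})$, and let $\tau[b^m]$ be the number of occurrences of $(b,m)$ in $\tau$. Let $x_{ij}$ $(i,j\ge 1)$ be indeterminates, with $x_{ij}$ of degree $i$. Let $H_b$ be the sum of all monomials of degree $b$ in the $x_{ij}$, and for a type $\lambda$ put $H_\lambda=\prod_{b^m\in\lambda}\psi_m(H_b)$ (product with multiplicity), where $\psi_m$ is the substitution $x_{ij}\mapsto x_{ij}^m$. A monomial $x_{i_1j_1}^{m_1}\cdots x_{i_rj_r}^{m_r}$ in distinct indeterminates with all $m_k\ge1$ has type $(i_1^{m_1}\cdots i_r^{m_r})$, and $M_\tau$ is the sum of all monomials of type $\tau$. For $\lambda\vDash d$ there are unique integers $a_{\tau\lambda}$, the \emph{arrangement numbers}, with $$H_\lambda=\sum_{\tau\vDash d}a_{\tau\lambda}M_\tau .$$ \textbf{Theorem.} Let $d\ge 1$. The matrix $a=(a_{\tau\lambda})_{\tau,\lambda\vDash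 d}$ is invertible over $\mathbb{Q}$. Let $a^{-1}_{\tau d}$ be the entry of $a^{-1}$ in row $\tau$ and in the column of the type $d=(d^1)$. Then for every type $\tau$ of degree $d$: \begin{enumerate} \item if $\tau$ is mixed, i.e. its parts do not all have the same multiplicity, then $a^{-1}_{\tau d}=0$; \item if all parts of $\tau=(b_1^m\cdots b_r^m)$ have the same multiplicity $m$, then $$a^{-1}_{\tau d}=\frac{\mu(m)}{m}\cdot\frac{(-1)^{r-1}}{r}\cdot\frac{r!}{\tau[1^m]!\cdots\tau[(d/m)^m]!},$$ where $\mu$ is the M\"obius function. \end{enumerate} -/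

import Mathlib

noncomputable section

namespace Polysymmetric

/-- The index set of the indeterminates `x_{ij}` (`i, j ≥ 1`); `x_{ij}` has degree `i`. -/
abbrev Var : Type := ℕ+ × ℕ+

/-- A monomial in the indeterminates `x_{ij}`, given by its exponents. -/
abbrev Mon : Type := Var →₀ ℕ

/-- The degree of a monomial, where `x_{ij}` has degree `i`. -/
def degree (e : Mon) : ℕ := e.sum fun v k => k * (v.1 : ℕ)

/-- The type `(i_1^{m_1} ⋯ i_r^{m_r})` of the monomial `x_{i_1j_1}^{m_1} ⋯ x_{i_rj_r}^{m_r}`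
(distinct indeterminates, positive exponents). -/
def monType (e : Mon) : Multiset (ℕ × ℕ) := e.support.val.map fun v => ((v.1 : ℕ), e v)

/-- Types of degree `d`: finite multisets of pairs `(b, m)` of positive integers, written `b^m`,
with `∑ b * m = d`. -/
abbrev PolyType (d : ℕ) : Type :=
  {τ : Multiset (ℕ × ℕ) // (∀ p ∈ τ, 0 < p.1 ∧ 0 < p.2) ∧ (τ.map fun p => p.1 * p.2).sum = d}

instance instFinitePolyType (d : ℕ) : Finite (PolyType d) := by
  classical
  refine Set.Finite.subset
    (Set.finite_Icc (0 : Multiset (ℕ × ℕ)) (d • (Finset.Icc 1 d ×ˢ Finset.Icc 1 d).val)) ?_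
  rintro τ ⟨hpos, hsum⟩
  refine ⟨zero_le, Multiset.le_iff_count.2 fun p => ?_⟩
  by_cases hp : p ∈ τ
  · have hle : p.1 * p.2 ≤ d := by
      rw [← hsum]
      exact Multiset.single_le_sum (fun _ _ => Nat.zero_le _) _ (Multiset.mem_map_of_mem _ hp)
    have h12 := hpos p hp
    have h1 : p.1 ≤ d := le_trans (Nat.le_mul_of_pos_right _ h12.2) hle
    have h2 : p.2 ≤ d := le_trans (Nat.le_mul_of_pos_left _ h12.1) hle
    have hmem : p ∈ (Finset.Icc 1 d ×ˢ Finset.Icc 1 d) := by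
      simp only [Finset.mem_product, Finset.mem_Icc]; omega
    have hcard : τ.card ≤ d := by
      have : (τ.map fun p => p.1 * p.2).card • 1 ≤ (τ.map fun p => p.1 * p.2).sum := by
        refine Multiset.card_nsmul_le_sum fun x hx => ?_
        obtain ⟨q, hq, rfl⟩ := Multiset.mem_map.1 hx
        exact Nat.mul_pos (hpos q hq).1 (hpos q hq).2
      simpa [hsum] using this
    have hc1 : (Finset.Icc 1 d ×ˢ Finset.Icc 1 d).val.count p = 1 :=
      Multiset.count_eq_one_of_mem (Finset.nodup _) hmem
    rw [Multiset.count_nsmul, hc1]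
    exact le_trans (Multiset.count_le_card _ _) (by simpa using hcard)
  · rw [Multiset.count_eq_zero_of_notMem hp]; exact Nat.zero_le _

instance instFintypePolyType (d : ℕ) : Fintype (PolyType d) := Fintype.ofFinite _

/-- The type `d = (d^1)`, the top stratum in degree `d ≥ 1`. -/
def topType (d : ℕ) (hd : 0 < d) : PolyType d := ⟨{(d, 1)}, by simp [hd], by simp⟩

/-- The `d`-th complete homogeneous polysymmetric function `H_d`,
the sum of all monomials of degree `d`. -/
def completeHom (d : ℕ) : MvPowerSeries Var ℤ := fun e => if degree e = d then 1 else 0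

/-- The Adams operation `ψ_m` on power series in the `x_{ij}`, i.e. the substitution
`x_{ij} ↦ x_{ij}^m` (used for `m ≥ 1`). -/
def adams (m : ℕ) (F : MvPowerSeries Var ℤ) : MvPowerSeries Var ℤ :=
  MvPowerSeries.subst (fun v => (MvPowerSeries.X v : MvPowerSeries Var ℤ) ^ m) F

/-- `H_λ = ∏_{b^m ∈ λ} ψ_m (H_b)` (product with multiplicity). -/
def completeHomType (l : Multiset (ℕ × ℕ)) : MvPowerSeries Var ℤ :=
  (l.map fun p => adams p.2 (completeHom p.1)).prod

/-- The monomial polysymmetric function `M_τ`, the sum of all monomials of type `τ`. -/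
def monomialSymm (τ : Multiset (ℕ × ℕ)) : MvPowerSeries Var ℤ :=
  fun e => if monType e = τ then 1 else 0

/-- An arrangement of `b^m = (b_i^{m_i})_i` into `c^n = (c_j^{n_j})_j`: a matrix of nonnegative
integers `A` with `A n = m` and `Aᵀ b = c`. -/
def ArrangementVec {ι κ : Type} [Fintype ι] [Fintype κ] (b m : ι → ℕ) (c n : κ → ℕ) : Type :=
  {A : Matrix ι κ ℕ // A.mulVec n = m ∧ A.transpose.mulVec b = c}

/-- An arrangement of the type `τ` into the type `l`, with rows indexed by the parts of `τ` and
columns indexed by the parts of `l` (each part as often as it occurs). -/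
def Arrangement (τ l : Multiset (ℕ × ℕ)) : Type :=
  ArrangementVec (fun i : τ => (i : ℕ × ℕ).1) (fun i : τ => (i : ℕ × ℕ).2)
    (fun j : l => (j : ℕ × ℕ).1) (fun j : l => (j : ℕ × ℕ).2)

/-! Expansion of `H_λ` in the family `M_τ`. -/

theorem coeff_adams_completeHom (m b : ℕ) (hm : 0 < m) (e : Mon) :
    MvPowerSeries.coeff e (adams m (completeHom b)) =
      open Classical in if ∃ g : Mon, m • g = e ∧ degree g = b then 1 else 0 := by
  classical
  have hexp : adams m (completeHom b) = MvPowerSeries.expand m hm.ne' (completeHom b) := by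
    rw [MvPowerSeries.expand, MvPowerSeries.substAlgHom_apply]; rfl
  rw [hexp]
  by_cases h : ∃ g : Mon, m • g = e
  · obtain ⟨g, rfl⟩ := h
    rw [MvPowerSeries.coeff_expand_smul]
    have : (∃ g' : Mon, m • g' = m • g ∧ degree g' = b) ↔ degree g = b := by
      constructor
      · rintro ⟨g', h1, h2⟩
        have : g' = g := by
          ext v
          have := DFunLike.congr_fun h1 v
          simp only [Finsupp.smul_apply, smul_eq_mul] at this
          exact Nat.eq_of_mul_eq_mul_left hm this
        rw [← this]; exact h2
      · intro h; exact ⟨g, rfl, h⟩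
    simp only [this]
    rfl
  · rw [if_neg (fun ⟨g, hg, _⟩ => h ⟨g, hg⟩)]
    have : ∃ v, ¬ m ∣ e v := by
      by_contra! hc
      refine h ⟨e.mapRange (fun n => n / m) (Nat.zero_div m), ?_⟩
      ext v
      simp [Nat.mul_div_cancel' (hc v)]
    obtain ⟨v, hv⟩ := this
    exact MvPowerSeries.coeff_expand_of_not_dvd m hm.ne' _ hv

/-- Families of monomials `(f_j)` with `∏ f_j ^ n_j` the given monomial and `deg f_j = c_j`. -/
def Factorization (e : Mon) (l : Multiset (ℕ × ℕ)) : Type :=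
  {g : l → Mon // ∑ j : l, (j : ℕ × ℕ).2 • g j = e ∧ ∀ j : l, degree (g j) = (j : ℕ × ℕ).1}

theorem coeff_completeHomType (l : Multiset (ℕ × ℕ)) (hl : ∀ p ∈ l, 0 < p.2) (e : Mon) :
    MvPowerSeries.coeff e (completeHomType l) = (Nat.card (Factorization e l) : ℤ) := by
  classical
  have h1 : completeHomType l =
      ∏ j : l, adams (j : ℕ × ℕ).2 (completeHom (j : ℕ × ℕ).1) := by
    rw [completeHomType, ← Multiset.map_univ]; rfl
  have hl' : ∀ j : l, 0 < (j : ℕ × ℕ).2 := fun j => hl _ (Multiset.coe_mem)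
  rw [h1, MvPowerSeries.coeff_prod]
  simp only [coeff_adams_completeHom _ _ (hl' _)]
  simp only [Finset.prod_ite_zero, Finset.prod_const_one, Finset.sum_boole, Finset.mem_univ,
    true_imp_iff]
  norm_cast
  rw [← Nat.card_eq_finsetCard]
  refine (Nat.card_congr (Equiv.ofBijective
    (fun g : Factorization e l => (⟨Finsupp.equivFunOnFinite.symm
      (fun j : l => (j : ℕ × ℕ).2 • g.1 j), ?_⟩ : {x // x ∈ _})) ⟨?_, ?_⟩)).symm
  · rw [Finset.mem_filter, Finset.mem_finsuppAntidiag]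
    exact ⟨⟨g.2.1, Finset.subset_univ _⟩, fun j => ⟨g.1 j, rfl, g.2.2 j⟩⟩
  · intro g g' h
    refine Subtype.ext (funext fun j => Finsupp.ext fun v => ?_)
    have := DFunLike.congr_fun (DFunLike.congr_fun (Subtype.ext_iff.1 h) j) v
    exact Nat.eq_of_mul_eq_mul_left (hl' j) this
  · rintro ⟨x, hx⟩
    rw [Finset.mem_filter, Finset.mem_finsuppAntidiag] at hx
    choose g hg hd using hx.2
    refine ⟨⟨g, ?_, hd⟩, Subtype.ext (Finsupp.ext fun j => hg j)⟩
    simp only [hg]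
    exact hx.1.1

theorem exists_equiv_of_map_eq {ι ι' α : Type} [Fintype ι] [Fintype ι'] (f : ι → α) (f' : ι' → α)
    (h : Finset.univ.val.map f = Finset.univ.val.map f') : ∃ φ : ι ≃ ι', ∀ i, f' (φ i) = f i := by
  classical
  have hc : ∀ a, Nonempty ({i // f i = a} ≃ {i // f' i = a}) := by
    intro a
    have := congrArg (Multiset.count a) h
    rw [Multiset.count_map, Multiset.count_map] at this
    refine ⟨Fintype.equivOfCardEq ?_⟩
    rw [Fintype.card_subtype, Fintype.card_subtype]
    simpa [Finset.card, eq_comm] using this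
  exact ⟨Equiv.ofFiberEquiv fun a => (hc a).some, fun i => Equiv.ofFiberEquiv_map _ i⟩

/-- Factorizations of a monomial correspond to arrangements of its type. -/
theorem card_factorization (e : Mon) (l : Multiset (ℕ × ℕ)) (hl : ∀ p ∈ l, 0 < p.2) :
    Nat.card (Factorization e l) = Nat.card (Arrangement (monType e) l) := by
  classical
  obtain ⟨φ, hφ⟩ := exists_equiv_of_map_eq (fun v : e.support => (((v : Var).1 : ℕ), e v))
    (fun i : monType e => (i : ℕ × ℕ)) (by
      rw [Multiset.map_univ_coe, monType]
      exact (Multiset.attach_map_val' e.support.val (fun v : Var => ((v.1 : ℕ), e v))))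
  have hl' : ∀ j : l, 0 < (j : ℕ × ℕ).2 := fun j => hl _ (Multiset.coe_mem)
  have hsupp : ∀ g : Factorization e l, ∀ j v, v ∉ e.support → g.1 j v = 0 := by
    intro g j v hv
    have h1 : ∑ j : l, (j : ℕ × ℕ).2 * g.1 j v = 0 := by
      have := DFunLike.congr_fun g.2.1 v
      rw [Finsupp.notMem_support_iff.1 hv] at this
      simpa [Finsupp.finsetSum_apply] using this
    have h2 := (Finset.sum_eq_zero_iff.1 h1) j (Finset.mem_univ j)
    exact (Nat.mul_eq_zero.1 h2).resolve_left (hl' j).ne'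
  have hdeg : ∀ g : Mon, (∀ v, v ∉ e.support → g v = 0) →
      degree g = ∑ v : e.support, g v * ((v : Var).1 : ℕ) := by
    intro g hg
    rw [degree, Finsupp.sum_of_support_subset (s := e.support) _ _ _ (by simp)]
    · exact (Finset.sum_coe_sort e.support fun v : Var => g v * (v.1 : ℕ)).symm
    · intro v hv
      by_contra hc
      exact (Finsupp.mem_support_iff.1 hv) (hg v hc)
  refine Nat.card_congr (Equiv.ofBijective (fun g : Factorization e l =>
    (⟨Matrix.of fun i j => g.1 j (φ.symm i), ?_, ?_⟩ : Arrangement (monType e) l)) ⟨?_, ?_⟩)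
  · funext i
    obtain ⟨v, rfl⟩ := φ.surjective i
    have := DFunLike.congr_fun g.2.1 (v : Var)
    rw [hφ]
    simpa [Matrix.mulVec, dotProduct, Finsupp.finsetSum_apply, mul_comm] using this
  · funext j
    rw [← g.2.2 j, hdeg _ (hsupp g j), ← Equiv.sum_comp φ.symm]
    simp only [Matrix.mulVec, dotProduct, Matrix.transpose_apply, Matrix.of_apply]
    refine Finset.sum_congr rfl fun i _ => ?_
    have := hφ (φ.symm i)
    rw [φ.apply_symm_apply] at this
    rw [this]
  · intro g g' h
    refine Subtype.ext (funext fun j => Finsupp.ext fun v => ?_)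
    by_cases hv : v ∈ e.support
    · have := congrFun (congrFun (Subtype.ext_iff.1 h) (φ ⟨v, hv⟩)) j
      simpa using this
    · rw [hsupp g j v hv, hsupp g' j v hv]
  · rintro ⟨A, h1, h2⟩
    let g : l → Mon := fun j => Finsupp.onFinset e.support
      (fun v => if hv : v ∈ e.support then A (φ ⟨v, hv⟩) j else 0)
      (fun v hv => by by_contra hc; exact hv (dif_neg hc))
    have hg : ∀ j (v : e.support), g j v = A (φ v) j := by
      intro j v
      show (if hv : (v : Var) ∈ e.support then A (φ ⟨v, hv⟩) j else 0) = _
      rw [dif_pos v.2]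
    have hg0 : ∀ j v, v ∉ e.support → g j v = 0 := fun j v hv => dif_neg hv
    refine ⟨⟨g, ?_, fun j => ?_⟩, Subtype.ext (Matrix.ext fun i j => ?_)⟩
    · ext v
      by_cases hv : v ∈ e.support
      · have h3 := congrFun h1 (φ ⟨v, hv⟩)
        rw [hφ] at h3
        have h4 : ∀ j, g j v = A (φ ⟨v, hv⟩) j := fun j => hg j ⟨v, hv⟩
        simpa [Matrix.mulVec, dotProduct, Finsupp.finsetSum_apply, mul_comm, h4] using h3
      · rw [Finsupp.notMem_support_iff.1 hv]
        simp [Finsupp.finsetSum_apply, hg0 _ v hv]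
    · rw [hdeg _ (hg0 j), ← congrFun h2 j, ← Equiv.sum_comp φ.symm]
      simp only [Matrix.mulVec, dotProduct, Matrix.transpose_apply]
      refine Finset.sum_congr rfl fun i _ => ?_
      have := hφ (φ.symm i)
      rw [φ.apply_symm_apply] at this
      rw [this, hg, φ.apply_symm_apply]
    · show g j (φ.symm i) = A i j
      rw [hg, φ.apply_symm_apply]

theorem degree_eq_sum_monType (e : Mon) :
    degree e = ((monType e).map fun p => p.1 * p.2).sum := by
  rw [degree, monType, Multiset.map_map, Finsupp.sum]
  refine Finset.sum_congr rfl fun v _ => ?_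
  exact mul_comm _ _

theorem monType_pos (e : Mon) : ∀ p ∈ monType e, 0 < p.1 ∧ 0 < p.2 := by
  intro p hp
  obtain ⟨v, hv, rfl⟩ := Multiset.mem_map.1 hp
  exact ⟨v.1.pos, Nat.pos_of_ne_zero (Finsupp.mem_support_iff.1 hv)⟩

theorem exists_monType {d : ℕ} (τ : PolyType d) : ∃ e : Mon, monType e = τ.1 := by
  classical
  have hpos : ∀ i : τ.1, 0 < (i : ℕ × ℕ).1 ∧ 0 < (i : ℕ × ℕ).2 :=
    fun i => τ.2.1 _ Multiset.coe_mem
  let k := Fintype.equivFin τ.1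
  let x : τ.1 ↪ Var :=
    ⟨fun i => (⟨(i : ℕ × ℕ).1, (hpos i).1⟩, ⟨(k i : ℕ) + 1, Nat.succ_pos _⟩), by
      intro i i' h
      have h2 := congrArg (fun v : Var => (v.2 : ℕ)) h
      simp only [PNat.mk_coe, add_left_inj] at h2
      exact k.injective (Fin.ext h2)⟩
  let w : τ.1 →₀ ℕ := Finsupp.equivFunOnFinite.symm fun i => (i : ℕ × ℕ).2
  refine ⟨w.embDomain x, ?_⟩
  have hs : w.support = Finset.univ := by
    ext i; simpa [w] using (hpos i).2.ne'
  rw [monType, Finsupp.support_embDomain, hs, Finset.map_val, Multiset.map_map]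
  conv_rhs => rw [← Multiset.map_univ_coe τ.1]
  refine Multiset.map_congr rfl fun i _ => ?_
  simp only [Function.comp_apply, Finsupp.embDomain_apply_self]
  rfl

theorem degree_of_factorization {d : ℕ} (e : Mon) (l : PolyType d) (g : Factorization e l.1) :
    degree e = d := by
  classical
  have hdeg : ∀ e : Mon, degree e = Finsupp.liftAddHom (M := ℕ) (N := ℕ)
      (fun v : Var => AddMonoidHom.mulRight ((v.1 : ℕ))) e := fun e => rfl
  have h := congrArg degree g.2.1
  rw [hdeg, map_sum] at h
  rw [← h]
  refine Eq.trans ?_ l.2.2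
  rw [← Multiset.map_univ l.1 fun p => p.1 * p.2]
  refine Finset.sum_congr rfl fun j _ => ?_
  rw [map_nsmul, ← hdeg, g.2.2, smul_eq_mul, mul_comm]

theorem completeHomType_eq_sum_card {d : ℕ} (l : PolyType d) :
    completeHomType l.1 =
      ∑ τ : PolyType d, (Nat.card (Arrangement τ.1 l.1) : ℤ) • monomialSymm τ.1 := by
  classical
  have hl : ∀ p ∈ l.1, 0 < p.2 := fun p hp => (l.2.1 p hp).2
  have hM : ∀ (τ : Multiset (ℕ × ℕ)) (e : Mon), MvPowerSeries.coeff e (monomialSymm τ) =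
      if monType e = τ then (1 : ℤ) else 0 := fun τ e => rfl
  ext e
  rw [coeff_completeHomType _ hl, map_sum]
  simp only [map_zsmul, hM]
  by_cases he : degree e = d
  · rw [Finset.sum_eq_single
      (⟨monType e, monType_pos e, by rw [← degree_eq_sum_monType, he]⟩ : PolyType d)]
    · simp [card_factorization e _ hl]
    · intro τ _ hτ
      rw [if_neg fun h => hτ (Subtype.ext h.symm), smul_zero]
    · intro h; exact absurd (Finset.mem_univ _) h
  · rw [Finset.sum_eq_zero]
    · have : IsEmpty (Factorization e l.1) := ⟨fun g => he (degree_of_factorization e l g)⟩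
      simp
    · intro τ _
      rw [if_neg, smul_zero]
      intro h
      exact he (by rw [degree_eq_sum_monType, h, τ.2.2])

/-- For `λ` of degree `d` there are unique integers `a(τ, λ)` with
`H_λ = ∑_τ a(τ, λ) M_τ`, the sum over all types `τ` of degree `d`. -/
theorem existsUnique_expansion {d : ℕ} (l : PolyType d) :
    ∃! a : PolyType d → ℤ, completeHomType l.1 = ∑ τ : PolyType d, a τ • monomialSymm τ.1 := by
  classical
  have hM : ∀ (τ : Multiset (ℕ × ℕ)) (e : Mon), MvPowerSeries.coeff e (monomialSymm τ) =
      if monType e = τ then (1 : ℤ) else 0 := fun τ e => rfl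
  have key : ∀ (a : PolyType d → ℤ) (σ : PolyType d) (e : Mon), monType e = σ.1 →
      MvPowerSeries.coeff e (∑ τ : PolyType d, a τ • monomialSymm τ.1) = a σ := by
    intro a σ e he
    rw [map_sum, Finset.sum_eq_single σ]
    · rw [map_zsmul, hM, if_pos he, smul_eq_mul, mul_one]
    · intro τ _ hτ
      rw [map_zsmul, hM, if_neg fun h => hτ (Subtype.ext (h.symm.trans he)), smul_zero]
    · intro h; exact absurd (Finset.mem_univ _) h
  refine ⟨_, completeHomType_eq_sum_card l, fun a ha => funext fun σ => ?_⟩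
  obtain ⟨e, he⟩ := exists_monType σ
  rw [← key a σ e he, ← ha, completeHomType_eq_sum_card l, key _ σ e he]

/-- The arrangement number `a(τ, λ)`: the coefficient of `M_τ` in `H_λ`. -/
def arrangementNumber {d : ℕ} (τ l : PolyType d) : ℤ := (existsUnique_expansion l).choose τ

theorem completeHomType_eq_sum {d : ℕ} (l : PolyType d) :
    completeHomType l.1 = ∑ τ : PolyType d, arrangementNumber τ l • monomialSymm τ.1 :=
  (existsUnique_expansion l).choose_spec.1

/-- `a(τ, λ)` is the number of arrangements of `τ` into `λ`. -/
theorem arrangementNumber_eq_card {d : ℕ} (τ l : PolyType d) :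
    arrangementNumber τ l = (Nat.card (Arrangement τ.1 l.1) : ℤ) :=
  (congrFun ((existsUnique_expansion l).choose_spec.2 _ (completeHomType_eq_sum_card l)) τ).symm

/-- The matrix `(a(τ, λ))`, over `ℚ`, with rows `τ` and columns `λ` running over the types of
degree `d`. -/
def arrangementMatrix (d : ℕ) : Matrix (PolyType d) (PolyType d) ℚ :=
  Matrix.of fun τ l => (arrangementNumber τ l : ℚ)

/-- `τ` is `m`-pure: every part of `τ` has multiplicity `m`. -/
def IsPure (m : ℕ) (τ : Multiset (ℕ × ℕ)) : Prop := ∀ p ∈ τ, p.2 = m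

/-- `τ` is mixed: it is not `m`-pure for any `m ≥ 1`. -/
def IsMixed (τ : Multiset (ℕ × ℕ)) : Prop := ∀ m : ℕ, 0 < m → ¬ IsPure m τ

end Polysymmetric

end

/-!
An arrangement `A` of `b^m` into `c^n` satisfies `∑ m_i² - ∑ n_j² = ∑_j n_j (∑_i A_ij m_i - n_j)`,
and every bracket is nonnegative because the `j`-th column has a nonzero entry. So `∑ m_i²` strictly
exceeds `∑ n_j²` unless all brackets vanish, in which case `A` is a bijection of equal parts. Hence
the arrangement matrix is triangular with nonzero diagonal, and invertible.

For the column of `(d^1)`, let `H = 1 + ∑_{b ≥ 1} H_b = ∏_v (1 - x_v)⁻¹`. Then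
`log H = ∑_v ∑_{k ≥ 1} x_v^k / k`, and Möbius inversion gives
`∑_m (μ(m) / m) ψ_m (log H) = ∑_v x_v`, whose degree `d` part is `M_{(d)}`. Expanding
`log (1 + ∑_{b ≥ 1} H_b)` by the multinomial theorem writes `M_{(d)}` as a combination of the `H_λ`
with `λ` pure.
-/

noncomputable section

namespace Polysymmetric

/-! ### Triangularity of the arrangement matrix -/

section Triangularity

open Matrix

namespace ArrangementVec

variable {ι κ : Type} [Fintype ι] [Fintype κ] {b m : ι → ℕ} {c n : κ → ℕ}

theorem apply_mul_le (A : ArrangementVec b m c n) (i : ι) (j : κ) : A.1 i j * n j ≤ m i :=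
  (Finset.single_le_sum (f := fun k => A.1 i k * n k) (fun _ _ => zero_le)
    (Finset.mem_univ j)).trans (congrFun A.2.1 i).le

theorem le_of_apply_ne_zero (A : ArrangementVec b m c n) {i : ι} {j : κ} (h : A.1 i j ≠ 0) :
    n j ≤ m i :=
  (Nat.le_mul_of_pos_left _ (Nat.pos_of_ne_zero h)).trans (A.apply_mul_le i j)

theorem exists_apply_ne_zero (A : ArrangementVec b m c n) {j : κ} (hc : c j ≠ 0) :
    ∃ i, A.1 i j ≠ 0 := by
  by_contra! hcol
  exact hc (by simp [← congrFun A.2.2 j, mulVec, dotProduct, hcol])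

theorem finite (hn : ∀ j, 0 < n j) : Finite (ArrangementVec b m c n) := by
  have entry_lt (A : ArrangementVec b m c n) (i j) : A.1 i j < m i + 1 :=
    Nat.lt_succ_of_le ((Nat.le_mul_of_pos_right _ (hn j)).trans (A.apply_mul_le i j))
  refine Finite.of_injective (β := ∀ i, κ → Fin (m i + 1))
    (fun A i j => ⟨A.1 i j, entry_lt A i j⟩) fun A B h => Subtype.ext (Matrix.ext fun i j => ?_)
  exact Fin.ext_iff.1 (congrFun (congrFun h i) j)

theorem dotProduct_self_eq (A : ArrangementVec b m c n) : m ⬝ᵥ m = (m ᵥ* A.1) ⬝ᵥ n := by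
  rw [← dotProduct_mulVec, A.2.1]

theorem le_vecMul (A : ArrangementVec b m c n) (hc : ∀ j, c j ≠ 0) : n ≤ m ᵥ* A.1 := fun j => by
  obtain ⟨i, hi⟩ := A.exists_apply_ne_zero (hc j)
  calc n j ≤ m i := A.le_of_apply_ne_zero hi
    _ ≤ m i * A.1 i j := Nat.le_mul_of_pos_right _ (Nat.pos_of_ne_zero hi)
    _ ≤ (m ᵥ* A.1) j :=
      Finset.single_le_sum (f := fun i => m i * A.1 i j) (fun _ _ => zero_le) (Finset.mem_univ i)

theorem dotProduct_self_lt_of_vecMul_ne (A : ArrangementVec b m c n) (hc : ∀ j, c j ≠ 0)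
    (hn : ∀ j, 0 < n j) (hne : m ᵥ* A.1 ≠ n) : n ⬝ᵥ n < m ⬝ᵥ m := by
  obtain ⟨hle, j, hj⟩ := Pi.lt_def.1 ((A.le_vecMul hc).lt_of_ne hne.symm)
  rw [A.dotProduct_self_eq]
  exact Finset.sum_lt_sum (fun k _ => Nat.mul_le_mul_right _ (hle k))
    ⟨j, Finset.mem_univ j, Nat.mul_lt_mul_of_pos_right hj (hn j)⟩

theorem exists_col_eq_single (A : ArrangementVec b m c n) [DecidableEq ι] (hm : ∀ i, 0 < m i)
    (hA : m ᵥ* A.1 = n) {j : κ} (hc : c j ≠ 0) : ∃ i, A.1.col j = Pi.single i 1 ∧ m i = n j := by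
  obtain ⟨i, hi⟩ := A.exists_apply_ne_zero hc
  have hsum : m i * A.1 i j + ∑ k ∈ Finset.univ.erase i, m k * A.1 k j = n j := by
    rw [Finset.add_sum_erase _ (fun k => m k * A.1 k j) (Finset.mem_univ i)]
    exact congrFun hA j
  have hle : n j ≤ m i := A.le_of_apply_ne_zero hi
  have hge : m i ≤ m i * A.1 i j := Nat.le_mul_of_pos_right _ (Nat.pos_of_ne_zero hi)
  have hone : A.1 i j = 1 := Nat.eq_of_mul_eq_mul_left (hm i) (by omega)
  have hzero : ∑ k ∈ Finset.univ.erase i, m k * A.1 k j = 0 := by omega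
  refine ⟨i, funext fun k => ?_, by omega⟩
  obtain rfl | hk := eq_or_ne k i
  · rw [Pi.single_eq_same, col_apply, hone]
  · rw [Pi.single_eq_of_ne hk, col_apply]
    have := Finset.sum_eq_zero_iff.1 hzero k (Finset.mem_erase.2 ⟨hk, Finset.mem_univ k⟩)
    exact (Nat.mul_eq_zero.1 this).resolve_left (hm k).ne'

theorem exists_equiv (A : ArrangementVec b m c n) (hm : ∀ i, 0 < m i) (hc : ∀ j, c j ≠ 0)
    (hA : m ᵥ* A.1 = n) : ∃ e : κ ≃ ι, ∀ j, b (e j) = c j ∧ m (e j) = n j := by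
  classical
  choose q hq hqn using fun j => A.exists_col_eq_single hm hA (hc j)
  have entry (i j) : A.1 i j = if i = q j then 1 else 0 := by
    rw [← col_apply A.1, hq, Pi.single_apply]
  have hrow (i) : ∑ j with i = q j, n j = m i := by
    rw [← A.2.1]
    simp only [mulVec, dotProduct, entry, ite_mul, one_mul, zero_mul, Finset.sum_filter]
  have hinj : Function.Injective q := fun j k hjk => by
    by_contra hne
    have hpair : n j + n k ≤ m (q j) := by
      rw [← hrow, ← Finset.sum_pair hne]
      exact Finset.sum_le_sum_of_subset (by simp [Finset.insert_subset_iff, hjk])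
    have := hm (q j)
    have := hqn j
    have := hjk ▸ hqn k
    omega
  have hsurj : Function.Surjective q := fun i => by
    by_contra! hi
    have := hrow i
    rw [Finset.filter_false_of_mem fun j _ => (hi j).symm, Finset.sum_empty] at this
    exact (hm i).ne this
  refine ⟨Equiv.ofBijective q ⟨hinj, hsurj⟩, fun j => ⟨?_, hqn j⟩⟩
  rw [← A.2.2]
  simp only [mulVec, dotProduct, transpose_apply, entry, ite_mul, one_mul, zero_mul,
    Finset.sum_ite_eq', Finset.mem_univ, if_true]
  rfl

end ArrangementVec

/-- The sum of the squares of the multiplicities of the parts of a type: an order parameter for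
which the arrangement matrix is triangular. -/
def sqMult (τ : Multiset (ℕ × ℕ)) : ℕ := (τ.map fun p => p.2 * p.2).sum

theorem sqMult_eq_dotProduct (τ : Multiset (ℕ × ℕ)) :
    sqMult τ = (fun i : τ => (i : ℕ × ℕ).2) ⬝ᵥ fun i : τ => (i : ℕ × ℕ).2 := by
  rw [sqMult, ← Multiset.map_univ τ fun p => p.2 * p.2]; rfl

theorem Arrangement.eq_or_sqMult_lt {τ l : Multiset (ℕ × ℕ)} (hτ : ∀ p ∈ τ, 0 < p.2)
    (hl : ∀ p ∈ l, 0 < p.1 ∧ 0 < p.2) (A : Arrangement τ l) : τ = l ∨ sqMult l < sqMult τ := by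
  have hc (j : l) : (j : ℕ × ℕ).1 ≠ 0 := (hl _ Multiset.coe_mem).1.ne'
  have hn (j : l) : 0 < (j : ℕ × ℕ).2 := (hl _ Multiset.coe_mem).2
  rw [sqMult_eq_dotProduct, sqMult_eq_dotProduct]
  refine or_iff_not_imp_right.2 fun hlt => ?_
  obtain ⟨e, he⟩ := ArrangementVec.exists_equiv A (fun i => hτ _ Multiset.coe_mem) hc
    (not_imp_comm.1 (ArrangementVec.dotProduct_self_lt_of_vecMul_ne A hc hn) hlt)
  rw [← Multiset.map_univ_coe τ, ← Multiset.map_univ_coe l, ← Finset.map_univ_equiv e,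
    Finset.map_val, Multiset.map_map]
  exact Multiset.map_congr rfl fun j _ => Prod.ext (he j).1 (he j).2

variable {d : ℕ}

theorem arrangementMatrix_apply (τ l : PolyType d) :
    arrangementMatrix d τ l = arrangementNumber τ l :=
  rfl

theorem arrangementNumber_self_ne_zero (τ : PolyType d) : arrangementNumber τ τ ≠ 0 := by
  classical
  rw [arrangementNumber_eq_card, Nat.cast_ne_zero, ← Nat.pos_iff_ne_zero, Nat.card_pos_iff]
  exact ⟨⟨1, one_mulVec _, by rw [transpose_one, one_mulVec]⟩,
    ArrangementVec.finite fun _ => (τ.2.1 _ Multiset.coe_mem).2⟩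

theorem arrangementNumber_eq_zero {τ l : PolyType d} (hne : l ≠ τ)
    (hle : sqMult τ.1 ≤ sqMult l.1) : arrangementNumber τ l = 0 := by
  have : IsEmpty (Arrangement τ.1 l.1) := ⟨fun A =>
    (A.eq_or_sqMult_lt (fun p hp => (τ.2.1 p hp).2) l.2.1).elim
      (fun h => hne (Subtype.ext h.symm)) hle.not_gt⟩
  rw [arrangementNumber_eq_card, Nat.card_of_isEmpty, Nat.cast_zero]

theorem isUnit_arrangementMatrix (d : ℕ) : IsUnit (arrangementMatrix d) := by
  rw [← mulVec_injective_iff_isUnit]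
  refine (injective_iff_map_eq_zero (mulVecLin (arrangementMatrix d))).2 fun v hv => funext ?_
  by_contra! hne
  obtain ⟨τ, hτ, hmin⟩ := Set.exists_min_image {τ : PolyType d | v τ ≠ 0} (fun τ => sqMult τ.1)
    (Set.toFinite _) hne
  have hoff : ∀ l ≠ τ, arrangementMatrix d τ l * v l = 0 := fun l hl => by
    by_cases hvl : v l = 0
    · rw [hvl, mul_zero]
    · rw [arrangementMatrix_apply, arrangementNumber_eq_zero hl (hmin l hvl), Int.cast_zero,
        zero_mul]
  have hdiag : arrangementMatrix d τ τ * v τ = 0 :=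
    (Fintype.sum_eq_single τ hoff).symm.trans (congrFun hv τ)
  exact hτ ((mul_eq_zero.1 hdiag).resolve_left
    (Int.cast_ne_zero.2 (arrangementNumber_self_ne_zero τ)))

end Triangularity

open MvPowerSeries

/-! ### Powers of and substitution into power series -/

section Powers

variable {σ R : Type*} [CommSemiring R] {w : σ → ℕ} {F : MvPowerSeries σ R}

theorem coeff_pow_congr {G : MvPowerSeries σ R} {e : σ →₀ ℕ}
    (h : ∀ g ≤ e, coeff g F = coeff g G) (r : ℕ) : coeff e (F ^ r) = coeff e (G ^ r) := by
  classical
  rw [coeff_pow, coeff_pow]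
  exact Finset.sum_congr rfl fun l hl => Finset.prod_congr rfl fun i hi =>
    h _ ((Finset.mem_finsuppAntidiag.1 hl).1 ▸
      Finset.single_le_sum (f := l) (fun _ _ => zero_le) hi)

theorem coeff_pow_eq_zero_of_degree_lt (hF : F.constantCoeff = 0)
    {e : σ →₀ ℕ} {r : ℕ} (hr : e.degree < r) : coeff e (F ^ r) = 0 :=
  coeff_of_lt_order ((Nat.cast_lt.2 hr).trans_le (le_order_pow_of_constantCoeff_eq_zero r hF))

theorem constantCoeff_eq_zero_of_weightedHomogeneousComponent
    (hF : F.weightedHomogeneousComponent w 0 = 0) : F.constantCoeff = 0 := by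
  have h := congrArg (coeff 0) hF
  rwa [coeff_weightedHomogeneousComponent, map_zero, if_pos rfl, map_zero,
    coeff_zero_eq_constantCoeff_apply] at h

theorem isWeightedHomogeneous_prod_weightedHomogeneousComponent (F : MvPowerSeries σ R)
    (w : σ → ℕ) (s : Multiset ℕ) :
    IsWeightedHomogeneous w (s.map fun b => F.weightedHomogeneousComponent w b).prod s.sum := by
  classical
  induction s using Multiset.induction_on with
  | empty =>
    intro e he
    rw [Multiset.map_zero, Multiset.prod_zero, coeff_one, ite_ne_right_iff] at he
    rw [he.1, map_zero, Multiset.sum_zero]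
  | cons b s ih =>
    rw [Multiset.map_cons, Multiset.prod_cons, Multiset.sum_cons]
    exact IsWeightedHomogeneous.mul (isWeightedHomogeneous_weightedHomogeneousComponent w F b) ih

theorem coeff_sum_weightedHomogeneousComponent (hF : F.weightedHomogeneousComponent w 0 = 0)
    {e : σ →₀ ℕ} {n : ℕ} (hn : Finsupp.weight w e ≤ n) :
    coeff e (∑ b ∈ Finset.Icc 1 n, F.weightedHomogeneousComponent w b) = coeff e F := by
  simp only [map_sum, coeff_weightedHomogeneousComponent, Finset.sum_ite_eq, Finset.mem_Icc]
  rw [ite_eq_left_iff, not_and', not_le, Nat.lt_one_iff]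
  intro h0
  have h := congrArg (coeff e) hF
  rwa [coeff_weightedHomogeneousComponent, map_zero, if_pos (h0 hn), eq_comm] at h

theorem coeff_pow_eq_sum_partition (hF : F.weightedHomogeneousComponent w 0 = 0) (e : σ →₀ ℕ)
    (r : ℕ) : coeff e (F ^ r) = ∑ p : (Finsupp.weight w e).Partition with p.parts.card = r,
      p.parts.countPerms *
        coeff e (p.parts.map fun b => F.weightedHomogeneousComponent w b).prod := by
  have hle {g : σ →₀ ℕ} (hg : g ≤ e) : Finsupp.weight w g ≤ Finsupp.weight w e := by
    rw [← add_tsub_cancel_of_le hg, map_add]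
    exact Nat.le_add_right _ _
  rw [← coeff_pow_congr (fun g hg => coeff_sum_weightedHomogeneousComponent hF (hle hg)),
    Finset.sum_pow, map_sum]
  simp only [← nsmul_eq_mul, map_nsmul]
  refine Finset.sum_bij_ne_zero (fun k hk hne => ⟨k.1, fun hb => ?_, ?_⟩) ?_ ?_ ?_ ?_
  · exact (Finset.mem_Icc.1 (Finset.mem_sym_iff.1 hk _ hb)).1
  · by_contra hsum
    refine hne ?_
    rw [IsWeightedHomogeneous.coeff_eq_zero
      (isWeightedHomogeneous_prod_weightedHomogeneousComponent F w k.1) (Ne.symm hsum), smul_zero]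
  · exact fun k _ _ => Finset.mem_filter.2 ⟨Finset.mem_univ _, k.2⟩
  · exact fun k _ _ l _ _ h => Subtype.ext (congrArg Nat.Partition.parts h)
  · refine fun p hp hne => ⟨⟨p.parts, (Finset.mem_filter.1 hp).2⟩, ?_, hne, rfl⟩
    exact Finset.mem_sym_iff.2 fun b hb => Finset.mem_Icc.2 ⟨p.parts_pos hb, p.le_of_mem_parts hb⟩
  · exact fun _ _ _ => rfl

end Powers

theorem card_parts_le {n : ℕ} (p : n.Partition) : p.parts.card ≤ n := by
  simpa [p.parts_sum] using Multiset.card_nsmul_le_sum (a := 1) fun _ => p.parts_pos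

section Substitution

variable {σ R : Type*} [CommRing R]

theorem coeff_subst_eq_sum_range {F : MvPowerSeries σ R} (hF : F.constantCoeff = 0)
    (f : PowerSeries R) {e : σ →₀ ℕ} {N : ℕ} (hN : e.degree < N) :
    coeff e (f.subst F) = ∑ r ∈ Finset.range N, PowerSeries.coeff r f * coeff e (F ^ r) := by
  rw [PowerSeries.coeff_subst (.of_constantCoeff_zero hF)]
  refine finsum_eq_sum_of_support_subset _ fun r hr => ?_
  by_contra hle
  rw [Finset.coe_range, Set.mem_Iio, not_lt] at hle
  exact hr (by simp only [coeff_pow_eq_zero_of_degree_lt hF (hN.trans_le hle), smul_zero])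

theorem pderiv_subst {F : MvPowerSeries σ R} (hF : F.constantCoeff = 0) (f : PowerSeries R)
    (v : σ) :
    pderiv R v (f.subst F) = (PowerSeries.derivative R f).subst F * pderiv R v F := by
  classical
  ext e
  have hdeg : (e + Finsupp.single v 1).degree < e.degree + 2 := by simp [map_add]
  set P := ∑ r ∈ Finset.range (e.degree + 2), PowerSeries.coeff r f • F ^ r with hP
  have hleft : coeff e (pderiv R v (f.subst F)) = coeff e (pderiv R v P) := by
    simp only [hP, coeff_pderiv, coeff_subst_eq_sum_range hF f hdeg, map_sum, map_smul, smul_eq_mul,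
      Finset.sum_mul]
  rw [hleft, hP, map_sum, Finset.sum_range_succ']
  have hpow (r : ℕ) : pderiv R v (PowerSeries.coeff (r + 1) f • F ^ (r + 1)) =
      PowerSeries.coeff r (PowerSeries.derivative R f) • F ^ r * pderiv R v F := by
    rw [Derivation.map_smul, pderiv_pow, PowerSeries.coeff_derivative, Nat.add_sub_cancel,
      mul_assoc, ← nsmul_eq_mul, ← Nat.cast_smul_eq_nsmul R, smul_smul, Nat.cast_succ,
      smul_mul_assoc]
  simp only [hpow, ← Finset.sum_mul, map_add, coeff_mul]
  rw [pow_zero, Derivation.map_smul, pderiv_one, smul_zero, map_zero, add_zero]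
  refine Finset.sum_congr rfl fun p hp => ?_
  have hp1 : p.1.degree < e.degree + 1 := by
    rw [← Finset.HasAntidiagonal.mem_antidiagonal.1 hp, map_add]
    omega
  simp only [coeff_subst_eq_sum_range hF _ hp1, map_sum, map_smul, smul_eq_mul]

theorem coeff_X_mul_pderiv (F : MvPowerSeries σ R) (v : σ) (e : σ →₀ ℕ) :
    coeff e (X v * pderiv R v F) = e v * coeff e F := by
  rw [X, coeff_monomial_mul, one_mul, coeff_pderiv]
  split_ifs with hv
  · rw [tsub_add_cancel_of_le hv, Finsupp.tsub_apply, Finsupp.single_eq_same,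
      Nat.cast_sub (Finsupp.single_le_iff.1 hv), Nat.cast_one, sub_add_cancel, mul_comm]
  · rw [Nat.lt_one_iff.1 (not_le.1 (mt Finsupp.single_le_iff.2 hv)), Nat.cast_zero, zero_mul]

theorem coeff_one_sub_X_mul_pderiv (F : MvPowerSeries σ R) (v : σ) (e : σ →₀ ℕ) :
    coeff e ((1 - X v) * pderiv R v F) =
      coeff (e + Finsupp.single v 1) F * (e v + 1) - e v * coeff e F := by
  rw [sub_mul, one_mul, map_sub, coeff_pderiv, coeff_X_mul_pderiv]

theorem coeff_subst_eq_sum_partition {w : σ → ℕ} {F : MvPowerSeries σ R}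
    (hF : F.weightedHomogeneousComponent w 0 = 0) (f : PowerSeries R) (e : σ →₀ ℕ) :
    coeff e (f.subst F) = ∑ p : (Finsupp.weight w e).Partition,
      PowerSeries.coeff p.parts.card f * p.parts.countPerms *
        coeff e (p.parts.map fun b => F.weightedHomogeneousComponent w b).prod := by
  rw [coeff_subst_eq_sum_range (constantCoeff_eq_zero_of_weightedHomogeneousComponent hF) f
    (N := e.degree + Finsupp.weight w e + 1) (by omega), ← Finset.sum_fiberwise_of_maps_to
    (g := fun p : (Finsupp.weight w e).Partition => p.parts.card)]
  · refine Finset.sum_congr rfl fun r _ => ?_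
    rw [coeff_pow_eq_sum_partition hF, Finset.mul_sum]
    refine Finset.sum_congr rfl fun p hp => ?_
    rw [(Finset.mem_filter.1 hp).2, mul_assoc]
  · intro p _
    have := card_parts_le p
    exact Finset.mem_range.2 (by omega)

end Substitution

/-! ### The logarithm of the sum of all monomials -/

section LogSumMonomials

variable {σ : Type*}

/-- The sum of all monomials in the variables `σ`, i.e. `∏ v, (1 - X v)⁻¹`. -/
def sumMonomials (σ : Type*) : MvPowerSeries σ ℚ := fun _ => 1

/-- The power-sum series `∑ v, ∑ k ≥ 1, X v ^ k / k`, the logarithm of `sumMonomials σ`. -/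
def logSumMonomials (σ : Type*) : MvPowerSeries σ ℚ :=
  fun e => if e.support.card = 1 then (e.degree : ℚ)⁻¹ else 0

theorem coeff_sumMonomials (e : σ →₀ ℕ) : coeff e (sumMonomials σ) = 1 := rfl

theorem coeff_logSumMonomials (e : σ →₀ ℕ) :
    coeff e (logSumMonomials σ) = if e.support.card = 1 then (e.degree : ℚ)⁻¹ else 0 := rfl

theorem constantCoeff_sumMonomials : (sumMonomials σ).constantCoeff = 1 := rfl

theorem constantCoeff_sumMonomials_sub_one : (sumMonomials σ - 1).constantCoeff = 0 := by
  rw [map_sub, map_one, constantCoeff_sumMonomials, sub_self]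

theorem one_sub_X_mul_pderiv_sumMonomials (v : σ) :
    (1 - X v) * pderiv ℚ v (sumMonomials σ) = sumMonomials σ := by
  ext e
  simp only [coeff_one_sub_X_mul_pderiv, coeff_sumMonomials]
  ring

theorem card_support_add_single_eq_one_iff (e : σ →₀ ℕ) (v : σ) :
    (e + Finsupp.single v 1).support.card = 1 ↔ e = Finsupp.single v (e v) := by
  classical
  have hsupp : (e + Finsupp.single v 1).support = insert v e.support := by
    ext w
    by_cases hw : w = v <;> simp [hw]
  rw [hsupp, ← Finsupp.support_subset_singleton, Finset.card_eq_one]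
  constructor
  · rintro ⟨w, hw⟩
    obtain rfl : v = w := Finset.mem_singleton.1 (hw ▸ Finset.mem_insert_self v e.support)
    exact hw ▸ Finset.subset_insert v e.support
  · exact fun h => ⟨v, (Finset.insert_subset_iff.2 ⟨Finset.mem_singleton_self v, h⟩).antisymm
      (Finset.singleton_subset_iff.2 (Finset.mem_insert_self v _))⟩

open Classical in
theorem coeff_pderiv_logSumMonomials (e : σ →₀ ℕ) (v : σ) :
    coeff e (pderiv ℚ v (logSumMonomials σ)) = if e = Finsupp.single v (e v) then 1 else 0 := by
  rw [coeff_pderiv, coeff_logSumMonomials]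
  simp only [card_support_add_single_eq_one_iff]
  split_ifs with he
  · rw [he, map_add, Finsupp.degree_single, Finsupp.degree_single, Finsupp.single_eq_same,
      Nat.cast_succ, inv_mul_cancel₀ (Nat.cast_add_one_ne_zero _)]
  · rw [zero_mul]

theorem one_sub_X_mul_pderiv_logSumMonomials (v : σ) :
    (1 - X v) * pderiv ℚ v (logSumMonomials σ) = 1 := by
  classical
  ext e
  rw [coeff_one_sub_X_mul_pderiv, ← coeff_pderiv, coeff_pderiv_logSumMonomials, coeff_one,
    coeff_logSumMonomials]
  by_cases hv : e v = 0
  · simp [hv]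
  · by_cases he : e = Finsupp.single v (e v)
    · rw [if_pos he, he]
      simp [hv]
    · have hcard : e.support.card ≠ 1 := fun h => by
        obtain ⟨w, b, -, rfl⟩ := Finsupp.card_support_eq_one'.1 h
        obtain rfl : w = v := by_contra fun hwv => hv (Finsupp.single_eq_of_ne' hwv)
        exact he (by rw [Finsupp.single_eq_same])
      rw [if_neg he, if_neg hcard, if_neg (by rintro rfl; exact hv rfl), mul_zero, sub_zero]

theorem derivative_log_mul_one_add_X (A : Type*) [CommRing A] [Algebra ℚ A] :
    PowerSeries.derivative A (PowerSeries.log A) * (1 + PowerSeries.X) = 1 := by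
  rw [PowerSeries.deriv_log, mul_add, mul_one]
  ext n
  cases n with
  | zero => simp
  | succ n => simp [PowerSeries.coeff_succ_mul_X, PowerSeries.coeff_one, pow_succ]

theorem mul_pderiv_log_subst {A : Type*} [CommRing A] [Algebra ℚ A] {F : MvPowerSeries σ A}
    (hF : F.constantCoeff = 0) (v : σ) :
    (1 + F) * pderiv A v ((PowerSeries.log A).subst F) = pderiv A v F := by
  have hsubst : PowerSeries.HasSubst F := .of_constantCoeff_zero hF
  have h := congrArg (PowerSeries.subst F) (derivative_log_mul_one_add_X A)
  rw [PowerSeries.subst_mul hsubst, PowerSeries.subst_add hsubst, PowerSeries.subst_X hsubst,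
    ← PowerSeries.coe_substAlgHom hsubst, map_one] at h
  rw [pderiv_subst hF, ← PowerSeries.coe_substAlgHom hsubst, ← mul_assoc, mul_comm (1 + F), h,
    one_mul]

theorem log_subst_sumMonomials_sub_one :
    (PowerSeries.log ℚ).subst (sumMonomials σ - 1) = logSumMonomials σ := by
  have hF := constantCoeff_sumMonomials_sub_one (σ := σ)
  refine pderiv.ext (fun v => ?_) ?_
  · have hne : sumMonomials σ * (1 - X v) ≠ 0 := fun h => by
      simpa [constantCoeff_sumMonomials] using congrArg constantCoeff h
    have hlog := mul_pderiv_log_subst hF v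
    rw [add_sub_cancel, map_sub, pderiv_one, sub_zero] at hlog
    refine mul_left_cancel₀ hne ?_
    rw [mul_right_comm, hlog, mul_assoc, one_sub_X_mul_pderiv_logSumMonomials, mul_one, mul_comm,
      one_sub_X_mul_pderiv_sumMonomials]
  · rw [PowerSeries.constantCoeff_subst_eq_zero hF _ PowerSeries.constantCoeff_log,
      ← coeff_zero_eq_constantCoeff_apply, coeff_logSumMonomials]
    simp

end LogSumMonomials

/-- The coefficient of `∏ b ∈ s, H b` in the multinomial expansion of `log (1 + ∑ b ≥ 1, H b)`. -/
def logWeight (s : Multiset ℕ) : ℚ := PowerSeries.coeff s.card (PowerSeries.log ℚ) * s.countPerms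

section LogExpansion

variable {σ : Type*} {w : σ → ℕ}

theorem weightedHomogeneousComponent_zero_sumMonomials_sub_one (hw : ∀ v, w v ≠ 0) :
    (sumMonomials σ - 1).weightedHomogeneousComponent w 0 = 0 := by
  have : Finsupp.NonTorsionWeight ℕ w := Finsupp.nonTorsionWeight_of ℕ w hw
  ext e
  rw [coeff_weightedHomogeneousComponent]
  split_ifs with he
  · rw [(Finsupp.weight_eq_zero_iff_eq_zero w).1 he, coeff_zero_eq_constantCoeff_apply,
      constantCoeff_sumMonomials_sub_one, map_zero]
  · rw [map_zero]

theorem weightedHomogeneousComponent_sumMonomials_sub_one {b : ℕ} (hb : b ≠ 0) :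
    (sumMonomials σ - 1).weightedHomogeneousComponent w b =
      (sumMonomials σ).weightedHomogeneousComponent w b := by
  classical
  ext e
  simp only [coeff_weightedHomogeneousComponent, map_sub, coeff_one]
  split_ifs with he h0
  · exact absurd (by rw [← he, h0, map_zero]) hb
  · rw [sub_zero]
  · rw [sub_zero]

theorem sum_logWeight_mul_coeff_prod (hw : ∀ v, w v ≠ 0) (e : σ →₀ ℕ) :
    ∑ p : (Finsupp.weight w e).Partition, logWeight p.parts * coeff e
        (p.parts.map fun b => (sumMonomials σ).weightedHomogeneousComponent w b).prod =
      coeff e (logSumMonomials σ) := by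
  rw [← log_subst_sumMonomials_sub_one, coeff_subst_eq_sum_partition
    (weightedHomogeneousComponent_zero_sumMonomials_sub_one hw)]
  refine Finset.sum_congr rfl fun p _ => ?_
  rw [logWeight, Multiset.map_congr rfl fun b hb =>
    weightedHomogeneousComponent_sumMonomials_sub_one (p.parts_pos hb).ne']

theorem exists_nsmul_eq_of_forall_dvd {m : ℕ} {e : σ →₀ ℕ} (h : ∀ v, m ∣ e v) :
    ∃ g : σ →₀ ℕ, m • g = e :=
  ⟨e.mapRange (· / m) (Nat.zero_div m), Finsupp.ext fun v => Nat.mul_div_cancel' (h v)⟩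

theorem sum_logWeight_mul_coeff_expand_prod (hw : ∀ v, w v ≠ 0) {m n : ℕ} (hm : m ≠ 0)
    {e : σ →₀ ℕ} (he : Finsupp.weight w e = m * n) :
    ∑ p : n.Partition, logWeight p.parts * coeff e (expand m hm
        (p.parts.map fun b => (sumMonomials σ).weightedHomogeneousComponent w b).prod) =
      coeff e (expand m hm (logSumMonomials σ)) := by
  by_cases hdvd : ∀ v, m ∣ e v
  · obtain ⟨g, rfl⟩ := exists_nsmul_eq_of_forall_dvd hdvd
    rw [map_nsmul, smul_eq_mul] at he
    obtain rfl := Nat.eq_of_mul_eq_mul_left (Nat.pos_of_ne_zero hm) he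
    simp only [coeff_expand_smul, sum_logWeight_mul_coeff_prod hw]
  · obtain ⟨v, hv⟩ := not_forall.1 hdvd
    simp only [coeff_expand_of_not_dvd m hm _ hv, mul_zero, Finset.sum_const_zero]

theorem coeff_expand_logSumMonomials {m : ℕ} (hm : m ≠ 0) (e : σ →₀ ℕ) :
    coeff e (expand m hm (logSumMonomials σ)) =
      if e.support.card = 1 ∧ m ∣ e.degree then (m : ℚ) / e.degree else 0 := by
  by_cases hdvd : ∀ v, m ∣ e v
  · obtain ⟨g, rfl⟩ := exists_nsmul_eq_of_forall_dvd hdvd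
    have hsupp : (m • g).support = g.support := Finsupp.support_smul_eq hm
    have hm' : (m : ℚ) ≠ 0 := Nat.cast_ne_zero.2 hm
    simp only [coeff_expand_smul, coeff_logSumMonomials, hsupp, map_nsmul, smul_eq_mul,
      Nat.cast_mul, dvd_mul_right, and_true, ← div_div, div_self hm', one_div]
  · obtain ⟨v, hv⟩ := not_forall.1 hdvd
    rw [coeff_expand_of_not_dvd m hm _ hv, if_neg]
    rintro ⟨hcard, hdeg⟩
    obtain ⟨u, k, -, rfl⟩ := Finsupp.card_support_eq_one'.1 hcard
    rw [Finsupp.degree_single] at hdeg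
    obtain rfl | hne := eq_or_ne u v
    · exact hv (by rwa [Finsupp.single_eq_same])
    · exact hv (by rw [Finsupp.single_eq_of_ne' hne]; exact dvd_zero m)

end LogExpansion

/-! ### The column of the top type -/

theorem sum_divisors_moebius_div_mul_ite {d k : ℕ} (hd : d ≠ 0) (hk : k ∣ d) :
    ∑ m ∈ d.divisors, ((ArithmeticFunction.moebius m : ℤ) : ℚ) / m *
      (if m ∣ k then (m : ℚ) / k else 0) = if k = 1 then 1 else 0 := by
  have hmoebius : ∑ m ∈ k.divisors, ((ArithmeticFunction.moebius m : ℤ) : ℚ) =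
      if k = 1 then 1 else 0 := by
    rw [← ArithmeticFunction.one_apply, ← ArithmeticFunction.coe_moebius_mul_coe_zeta,
      ArithmeticFunction.coe_mul_zeta_apply]
    rfl
  have hterm (m : ℕ) (hm : m ∈ k.divisors) :
      ((ArithmeticFunction.moebius m : ℤ) : ℚ) / m * (m / k) =
        ((ArithmeticFunction.moebius m : ℤ) : ℚ) / k :=
    div_mul_div_cancel₀ (Nat.cast_ne_zero.2 (Nat.pos_of_mem_divisors hm).ne')
  simp only [mul_ite, mul_zero]
  rw [← Finset.sum_filter, Nat.divisors_filter_dvd_of_dvd hd hk, Finset.sum_congr rfl hterm,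
    ← Finset.sum_div, hmoebius]
  split_ifs with h
  · rw [h, Nat.cast_one, div_one]
  · rw [zero_div]

theorem countPerms_eq_factorial_div {α : Type*} [DecidableEq α] {s : Multiset α} {t : Finset α}
    (hst : ∀ a ∈ s, a ∈ t) :
    (s.countPerms : ℚ) = (s.card.factorial : ℚ) / ∏ a ∈ t, ((s.count a).factorial : ℚ) := by
  have hmultinomial : s.countPerms = Nat.multinomial t s.count :=
    Finsupp.multinomial_eq_of_support_subset fun a ha => hst a (by simpa using ha)
  have hprod : ∏ a ∈ t, ((s.count a).factorial : ℚ) ≠ 0 :=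
    Finset.prod_ne_zero_iff.2 fun a _ => Nat.cast_ne_zero.2 (Nat.factorial_ne_zero _)
  rw [eq_div_iff hprod, mul_comm, hmultinomial, ← Multiset.sum_count_eq_card hst,
    ← Nat.multinomial_spec]
  push_cast
  rfl

section TopColumn

theorem degree_eq_weight (e : Mon) : degree e = Finsupp.weight (fun v : Var => (v.1 : ℕ)) e := rfl

theorem map_completeHom (b : ℕ) : map (Int.castRingHom ℚ) (completeHom b) =
    (sumMonomials Var).weightedHomogeneousComponent (fun v => (v.1 : ℕ)) b := by
  ext e
  rw [coeff_map, coeff_weightedHomogeneousComponent, ← degree_eq_weight]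
  exact apply_ite _ _ _ _

theorem map_completeHomType_pure {m : ℕ} (hm : m ≠ 0) (s : Multiset ℕ) :
    map (Int.castRingHom ℚ) (completeHomType (s.map fun b => (b, m))) =
      expand m hm (s.map fun b =>
        (sumMonomials Var).weightedHomogeneousComponent (fun v => (v.1 : ℕ)) b).prod := by
  have hadams (F : MvPowerSeries Var ℤ) : adams m F = expand m hm F := by
    rw [MvPowerSeries.expand, substAlgHom_apply]; rfl
  simp only [completeHomType, Multiset.map_map, Function.comp_def, hadams, map_multiset_prod,
    map_expand, map_completeHom]

variable {d m : ℕ}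

theorem PolyType.ne_zero (hd : 0 < d) (τ : PolyType d) : τ.1 ≠ 0 := fun h =>
  hd.ne (by simpa [h] using τ.2.2)

theorem PolyType.exists_mem (hd : 0 < d) (τ : PolyType d) : ∃ p, p ∈ τ.1 :=
  Multiset.exists_mem_of_ne_zero (τ.ne_zero hd)

theorem PolyType.pos_of_mem_map_fst (τ : PolyType d) : ∀ b ∈ τ.1.map Prod.fst, 0 < b :=
  fun b hb => by
    obtain ⟨p, hp, rfl⟩ := Multiset.mem_map.1 hb
    exact (τ.2.1 p hp).1

theorem IsPure.map_fst_map {l : Multiset (ℕ × ℕ)} (h : IsPure m l) :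
    (l.map Prod.fst).map (fun b => (b, m)) = l := by
  rw [Multiset.map_map]
  exact (Multiset.map_congr rfl fun p hp => show (p.1, m) = id p from
    Prod.ext rfl (h p hp).symm).trans (Multiset.map_id l)

theorem isPure_map (m : ℕ) (s : Multiset ℕ) : IsPure m (s.map fun b => (b, m)) := fun p hp => by
  obtain ⟨b, -, rfl⟩ := Multiset.mem_map.1 hp
  rfl

/-- The `m`-pure type whose parts `b ^ m` are given by the parts `b` of a partition. -/
def PolyType.ofPartition {n : ℕ} (hm : 0 < m) (p : n.Partition) : PolyType (m * n) :=
  ⟨p.parts.map fun b => (b, m),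
    fun q hq => by
      obtain ⟨b, hb, rfl⟩ := Multiset.mem_map.1 hq
      exact ⟨p.parts_pos hb, hm⟩,
    by rw [Multiset.map_map, Function.comp_def, Multiset.sum_map_mul_right, Multiset.map_id',
      p.parts_sum, mul_comm]⟩

theorem IsPure.mul_sum_map_fst {τ : PolyType d} (h : IsPure m τ.1) :
    m * (τ.1.map Prod.fst).sum = d := by
  rw [← Multiset.sum_map_mul_left]
  exact (congrArg Multiset.sum
    (Multiset.map_congr rfl fun p hp => by rw [h p hp, mul_comm])).trans τ.2.2

open Classical in
theorem sum_isPure_eq_sum_partition {n : ℕ} (hm : 0 < m) (f : Multiset (ℕ × ℕ) → ℚ) :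
    ∑ τ : PolyType (m * n) with IsPure m τ.1, f τ.1 =
      ∑ p : n.Partition, f (p.parts.map fun b => (b, m)) := by
  refine (Finset.sum_bij (fun p _ => PolyType.ofPartition hm p) ?_ ?_ ?_ ?_).symm
  · exact fun p _ => Finset.mem_filter.2 ⟨Finset.mem_univ _, isPure_map m p.parts⟩
  · exact fun p _ q _ h => Nat.Partition.ext
      (Multiset.map_injective (Prod.mk_left_injective m) (congrArg Subtype.val h))
  · intro τ hτ
    have hpure : IsPure m τ.1 := (Finset.mem_filter.1 hτ).2
    exact ⟨⟨τ.1.map Prod.fst, τ.pos_of_mem_map_fst _,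
      Nat.eq_of_mul_eq_mul_left hm hpure.mul_sum_map_fst⟩, Finset.mem_univ _,
      Subtype.ext hpure.map_fst_map⟩
  · exact fun _ _ => rfl

/-- The contribution of the `m`-pure types to the expansion of `M_{(d)}` in the `H_τ`, before the
weight `μ(m) / m`. -/
def pureLogColumn (m : ℕ) (τ : PolyType d) : ℚ :=
  open Classical in if IsPure m τ.1 then logWeight (τ.1.map Prod.fst) else 0

/-- The coefficients of the expansion of `M_{(d)}` in the `H_τ`. -/
def topColumn (d : ℕ) : PolyType d → ℚ :=
  ∑ m ∈ d.divisors, (((ArithmeticFunction.moebius m : ℤ) : ℚ) / m) • pureLogColumn m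

theorem arrangementNumber_eq_coeff {τ : PolyType d} {e : Mon} (he : monType e = τ.1)
    (l : PolyType d) : arrangementNumber τ l = coeff e (completeHomType l.1) := by
  have hl : ∀ p ∈ l.1, 0 < p.2 := fun p hp => (l.2.1 p hp).2
  rw [arrangementNumber_eq_card, coeff_completeHomType _ hl, card_factorization _ _ hl, he]

theorem degree_eq_of_monType_eq {τ : PolyType d} {e : Mon} (he : monType e = τ.1) :
    degree e = d := by
  rw [degree_eq_sum_monType, he, τ.2.2]

open Matrix in
theorem arrangementMatrix_mulVec_pureLogColumn (hm : m ≠ 0) (hmd : m ∣ d) {τ : PolyType d}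
    {e : Mon} (he : monType e = τ.1) :
    (arrangementMatrix d *ᵥ pureLogColumn m) τ = coeff e (expand m hm (logSumMonomials Var)) := by
  classical
  obtain ⟨n, rfl⟩ := hmd
  have hterm (l : PolyType (m * n)) : arrangementMatrix (m * n) τ l * pureLogColumn m l =
      if IsPure m l.1 then logWeight (l.1.map Prod.fst) *
        coeff e (map (Int.castRingHom ℚ) (completeHomType l.1)) else 0 := by
    rw [pureLogColumn, mul_ite, mul_zero, arrangementMatrix_apply, arrangementNumber_eq_coeff he,
      coeff_map, eq_intCast, mul_comm (logWeight _)]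
  rw [← sum_logWeight_mul_coeff_expand_prod (w := fun v : Var => (v.1 : ℕ)) (fun v => v.1.ne_zero)
    hm ((degree_eq_weight e).symm.trans (degree_eq_of_monType_eq he)), mulVec, dotProduct]
  simp only [hterm, ← Finset.sum_filter]
  rw [sum_isPure_eq_sum_partition (Nat.pos_of_ne_zero hm) fun l => logWeight (l.map Prod.fst) *
        coeff e (map (Int.castRingHom ℚ) (completeHomType l))]
  simp only [map_completeHomType_pure hm, Multiset.map_map, Function.comp_def, Multiset.map_id']

theorem monType_single (v : Var) {k : ℕ} (hk : k ≠ 0) :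
    monType (Finsupp.single v k) = {((v.1 : ℕ), k)} := by
  rw [monType, Finsupp.support_single _ hk, Finset.singleton_val, Multiset.map_singleton,
    Finsupp.single_eq_same]

theorem degree_single (v : Var) (k : ℕ) : degree (Finsupp.single v k) = k * v.1 :=
  Finsupp.sum_single_index (zero_mul _)

theorem degree_dvd_of_card_support_eq_one {e : Mon} (h : e.support.card = 1) :
    e.degree ∣ degree e := by
  obtain ⟨v, k, -, rfl⟩ := Finsupp.card_support_eq_one'.1 h
  rw [degree_single, Finsupp.degree_single]
  exact dvd_mul_right k v.1

theorem card_support_eq_card_monType (e : Mon) : e.support.card = (monType e).card :=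
  (Multiset.card_map _ _).symm

theorem eq_topType_iff (hd : 0 < d) {τ : PolyType d} {e : Mon} (he : monType e = τ.1) :
    τ = topType d hd ↔ e.support.card = 1 ∧ e.degree = 1 := by
  have hcard (h : τ = topType d hd) : e.support.card = 1 := by
    rw [card_support_eq_card_monType, he, h, topType, Multiset.card_singleton]
  rw [← and_iff_right_of_imp hcard]
  refine and_congr_right fun h => ?_
  obtain ⟨v, k, hk, rfl⟩ := Finsupp.card_support_eq_one'.1 h
  have hdeg := degree_eq_of_monType_eq he
  rw [degree_single] at hdeg
  rw [Subtype.ext_iff, ← he, monType_single v hk, topType, Multiset.singleton_inj, Prod.mk.injEq,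
    Finsupp.degree_single, and_iff_right_iff_imp]
  rintro rfl
  rw [← hdeg, one_mul]

open Matrix in
theorem arrangementMatrix_mulVec_topColumn (hd : 0 < d) :
    arrangementMatrix d *ᵥ topColumn d = Pi.single (topType d hd) 1 := by
  funext τ
  obtain ⟨e, he⟩ := exists_monType τ
  have hterm (m : ℕ) (hm : m ∈ d.divisors) :
      (arrangementMatrix d *ᵥ pureLogColumn m) τ =
        if e.support.card = 1 ∧ m ∣ e.degree then (m : ℚ) / e.degree else 0 := by
    rw [arrangementMatrix_mulVec_pureLogColumn (Nat.pos_of_mem_divisors hm).ne'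
      (Nat.dvd_of_mem_divisors hm) he, coeff_expand_logSumMonomials]
  simp only [topColumn, mulVec_sum, mulVec_smul, Finset.sum_apply, Pi.smul_apply, smul_eq_mul]
  rw [Finset.sum_congr rfl fun m hm => by rw [hterm m hm], Pi.single_apply]
  simp only [eq_topType_iff hd he]
  by_cases hcard : e.support.card = 1
  · have hdvd : e.degree ∣ d :=
      degree_eq_of_monType_eq he ▸ degree_dvd_of_card_support_eq_one hcard
    simp only [hcard, true_and, sum_divisors_moebius_div_mul_ite hd.ne' hdvd]
  · simp only [hcard, false_and, if_false, mul_zero, Finset.sum_const_zero]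

theorem inv_arrangementMatrix_apply_topType (hd : 0 < d) (τ : PolyType d) :
    (arrangementMatrix d)⁻¹ τ (topType d hd) = topColumn d τ := by
  have h := isUnit_arrangementMatrix d
  have hcol : (arrangementMatrix d)⁻¹.col (topType d hd) = topColumn d := by
    rw [← Matrix.mulVec_single_one, ← arrangementMatrix_mulVec_topColumn hd, Matrix.mulVec_mulVec,
      Matrix.nonsing_inv_mul _ ((Matrix.isUnit_iff_isUnit_det _).1 h), Matrix.one_mulVec]
  exact congrFun hcol τ

theorem topColumn_apply (τ : PolyType d) : topColumn d τ = ∑ m ∈ d.divisors,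
    ((ArithmeticFunction.moebius m : ℤ) : ℚ) / m * pureLogColumn m τ := by
  simp only [topColumn, Finset.sum_apply, Pi.smul_apply, smul_eq_mul]

theorem IsMixed.topColumn_eq_zero {τ : PolyType d} (h : IsMixed τ.1) : topColumn d τ = 0 := by
  rw [topColumn_apply]
  refine Finset.sum_eq_zero fun m hm => ?_
  rw [pureLogColumn, if_neg (h m (Nat.pos_of_mem_divisors hm)), mul_zero]

theorem IsPure.topColumn_eq (hd : 0 < d) {τ : PolyType d} (h : IsPure m τ.1) :
    topColumn d τ =
      ((ArithmeticFunction.moebius m : ℤ) : ℚ) / m * logWeight (τ.1.map Prod.fst) := by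
  obtain ⟨p, hp⟩ := τ.exists_mem hd
  rw [topColumn_apply, Finset.sum_eq_single m, pureLogColumn, if_pos h]
  · intro n _ hne
    rw [pureLogColumn, if_neg fun hn => hne ((hn p hp).symm.trans (h p hp)), mul_zero]
  · exact fun hm => absurd (Nat.mem_divisors.2 ⟨⟨_, h.mul_sum_map_fst.symm⟩, hd.ne'⟩) hm

theorem IsPure.count_mk {l : Multiset (ℕ × ℕ)} (h : IsPure m l) (b : ℕ) :
    l.count (b, m) = (l.map Prod.fst).count b := by
  conv_lhs => rw [← h.map_fst_map]
  exact Multiset.count_map_eq_count' _ _ (Prod.mk_left_injective m) b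

theorem IsPure.mem_Icc_of_mem_map_fst {τ : PolyType d} (h : IsPure m τ.1) {b : ℕ}
    (hb : b ∈ τ.1.map Prod.fst) : b ∈ Finset.Icc 1 (d / m) := by
  obtain ⟨p, hp, rfl⟩ := Multiset.mem_map.1 hb
  obtain ⟨hpos, hm⟩ := τ.2.1 p hp
  rw [h p hp] at hm
  refine Finset.mem_Icc.2 ⟨hpos, ?_⟩
  rw [Nat.div_eq_of_eq_mul_right hm h.mul_sum_map_fst.symm]
  exact Multiset.single_le_sum (fun _ _ => Nat.zero_le _) _ hb

theorem IsPure.logWeight_eq (hd : 0 < d) {τ : PolyType d} (h : IsPure m τ.1) :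
    logWeight (τ.1.map Prod.fst) = (-1) ^ (τ.1.card - 1) / (τ.1.card : ℚ) *
      ((τ.1.card.factorial : ℚ) /
        ∏ b ∈ Finset.Icc 1 (d / m), ((τ.1.count (b, m)).factorial : ℚ)) := by
  obtain ⟨k, hk⟩ := Nat.exists_eq_succ_of_ne_zero (mt Multiset.card_eq_zero.1 (τ.ne_zero hd))
  rw [logWeight, countPerms_eq_factorial_div fun _ => h.mem_Icc_of_mem_map_fst, Multiset.card_map,
    PowerSeries.coeff_log, hk, if_neg k.succ_ne_zero, Nat.succ_sub_one, pow_add, pow_succ]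
  simp [h.count_mk]

end TopColumn

end Polysymmetric

end

theorem mainTheorem5 (d : ℕ) (hd : 0 < d) :
    IsUnit (Polysymmetric.arrangementMatrix d) ∧
    ∀ τ : Polysymmetric.PolyType d,
      (Polysymmetric.IsMixed τ.1 →
        (Polysymmetric.arrangementMatrix d)⁻¹ τ (Polysymmetric.topType d hd) = 0) ∧
      ∀ m : ℕ, Polysymmetric.IsPure m τ.1 →
        (Polysymmetric.arrangementMatrix d)⁻¹ τ (Polysymmetric.topType d hd) =
          ((ArithmeticFunction.moebius m : ℤ) : ℚ) / (m : ℚ) *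
            ((-1 : ℚ) ^ (Multiset.card τ.1 - 1) / (Multiset.card τ.1 : ℚ)) *
            ((Nat.factorial (Multiset.card τ.1) : ℚ) /
              ∏ b ∈ Finset.Icc 1 (d / m), (Nat.factorial (τ.1.count (b, m)) : ℚ)) := by
  refine ⟨Polysymmetric.isUnit_arrangementMatrix d, fun τ => ?_⟩
  rw [Polysymmetric.inv_arrangementMatrix_apply_topType]
  refine ⟨fun hmixed => hmixed.topColumn_eq_zero, fun m hpure => ?_⟩
  rw [hpure.topColumn_eq hd, hpure.logWeight_eq hd, mul_assoc]
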